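/- Let $m\ge 1$, $M\ge 0$ be integers, $N_S\ge 0$ and $r_B,r_T\in[0,1]$. A block of $m$ cells $S_1,\dots,S_m$ contains one target cell, whose position $n$ is uniformly distributed on $\{1,\dots,m\}$. If each cell is probed with $K$ bosonic modes, the block acts on the input state $\rho$ of the $mK$ modes as the channel $\mathcal E_n=\big(\bigotimes_{k\ne n}\mathcal L_{r_B}^{\otimes K}\big)\otimes\mathcal L_{r_T}^{\otimes K}$, the last factor acting on cell $S_n$, where $\mathcal L_r$ is the single-mode pure-loss channel of reflectivity $r$. The minimum error probability (Helstrom limit) of the input $\rho$ is $$P_H(\rho)=\inf_{\{\Pi_n\}}\Big(1-\frac1m\sum_{n=1}^m\operatorname{Tr}[\mathcal E_n(\rho)\Pi_n]\Big),$$ the infimum being over the POVMs $\{\Pi_n\}_{n=1}^m$ on the $mK$ modes. For $0\le\zeta\le1$ put $$P_H(m,\zeta)=\frac{m-1}{m^2}\Big[\sqrt{1+(m-1)\zeta}-\sqrt{1-\zeta}\Big]^2 .$$ Let $|\alpha\rangle$ be the single-mode coherent state of amplitude $\alpha=\sqrt{MN_S}$, and let $$\zeta^{\rm CR}=\big|\langle\sqrt{r_B}\,\alpha|\sqrt{r_T}\,\alpha\rangle\big|^2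 .$$ Then: 1. $\zeta^{\rm CR}=e^{-MN_S(\sqrt{r_B}-\sqrt{r_T})^2}$. 2. The input $\rho_\star$ given by $\bigotimes_{k=1}^m|\alpha\rangle_{S_k}$ (one mode per cell) irradiates $MN_S$ mean photons over each cell and has $P_H(\rho_\star)=P_H(m,\zeta^{\rm CR})$, attained by a POVM. More generally, for every $K$ and every $K$-mode coherent state $|\boldsymbol\beta\rangle$ with $|\boldsymbol\beta|^2=MN_S$, the input $\bigotimes_{k=1}^m|\boldsymbol\beta\rangle_{S_k}$ has this same minimum error probability, also attained. 3. For every number $K$ of modes per cell and every probability measure $\nu$ on $\mathbb C^K$, if the mixture $\rho_C=\int d\nu(\boldsymbol\alpha)\,\bigotimes_{k=1}^m|\boldsymbol\alpha\rangle\langle\boldsymbol\alpha|_{S_k}$ irradiates at most $MN_S$ mean photons over each cell, then $P_H(\rho_C)\ge P_H(\rho_\star)=P_H(m,\zeta^{\rm CR})$. -/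

import Mathlib

open MeasureTheory
open scoped ENNReal

noncomputable section

/-! ### Bosonic modes

The Hilbert space of finitely many bosonic modes `ι` is `ℓ²(ι → ℕ)`, the Hilbert space with
orthonormal basis the Fock (occupation number) states `|n⟩ = ⨂ᵢ |nᵢ⟩`, `n : ι → ℕ`.  In this basis,
the matrix elements of a tensor product over the modes are the products of the matrix elements
of the factors. -/

/-- The Hilbert space of the bosonic modes `ι`. -/
abbrev FockSpace (ι : Type*) := lp (fun _ : ι → ℕ => ℂ) 2

/-- The Fock state `|n⟩`. -/
def fockState {ι : Type*} (n : ι → ℕ) : FockSpace ι :=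
  open Classical in lp.single 2 n (1 : ℂ)

/-- The coefficients `⟨n|α⟩ = e^{-|α|²/2} αⁿ / √(n!)` of a single-mode coherent state. -/
def coherentCoeff (α : ℂ) (n : ℕ) : ℂ :=
  (Real.exp (-‖α‖ ^ 2 / 2) : ℂ) * α ^ n / (Real.sqrt (n.factorial) : ℂ)

theorem norm_coherentCoeff_sq (α : ℂ) (n : ℕ) :
    ‖coherentCoeff α n‖ ^ 2 = Real.exp (-‖α‖ ^ 2) * ((‖α‖ ^ 2) ^ n / n.factorial) := by
  have h1 : Real.exp (-‖α‖ ^ 2 / 2) ^ 2 = Real.exp (-‖α‖ ^ 2) := by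
    rw [← Real.exp_nat_mul]; congr 1; push_cast; ring
  have h2 : Real.sqrt (n.factorial) ^ 2 = n.factorial := Real.sq_sqrt (Nat.cast_nonneg _)
  rw [coherentCoeff, norm_div, norm_mul, norm_pow, Complex.norm_real, Complex.norm_real,
    Real.norm_of_nonneg (Real.exp_pos _).le, Real.norm_of_nonneg (Real.sqrt_nonneg _),
    div_pow, mul_pow, h1, h2]
  ring

theorem hasSum_norm_coherentCoeff_sq (α : ℂ) :
    HasSum (fun n => ‖coherentCoeff α n‖ ^ 2) 1 := by
  have h := (NormedSpace.expSeries_div_hasSum_exp (‖α‖ ^ 2)).mul_left (Real.exp (-‖α‖ ^ 2))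
  rw [← Real.exp_eq_exp_ℝ, ← Real.exp_add, neg_add_cancel, Real.exp_zero] at h
  simpa only [norm_coherentCoeff_sq] using h

theorem memℓp_coherent {ι : Type*} [Fintype ι] (α : ι → ℂ) :
    Memℓp (fun n : ι → ℕ => ∏ i, coherentCoeff (α i) (n i)) 2 := by
  classical
  refine memℓp_gen ?_
  have e : ∀ n : ι → ℕ, ‖∏ i, coherentCoeff (α i) (n i)‖ ^ (2 : ℝ≥0∞).toReal
      = ∏ i, ‖coherentCoeff (α i) (n i)‖ ^ 2 := by
    intro n
    simp [norm_prod, Finset.prod_pow]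
  simp only [e]
  refine summable_of_sum_le (c := 1) (fun n => Finset.prod_nonneg fun i _ => sq_nonneg _) ?_
  intro s
  set t : ι → Finset ℕ := fun i => s.image (fun n => n i) with ht
  have hs : s ⊆ Fintype.piFinset t := by
    intro n hn
    rw [Fintype.mem_piFinset]
    exact fun i => Finset.mem_image_of_mem _ hn
  calc ∑ n ∈ s, ∏ i, ‖coherentCoeff (α i) (n i)‖ ^ 2
      ≤ ∑ n ∈ Fintype.piFinset t, ∏ i, ‖coherentCoeff (α i) (n i)‖ ^ 2 :=
        Finset.sum_le_sum_of_subset_of_nonneg hs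
          fun n _ _ => Finset.prod_nonneg fun i _ => sq_nonneg _
    _ = ∏ i, ∑ k ∈ t i, ‖coherentCoeff (α i) k‖ ^ 2 := 
        (Finset.prod_univ_sum t (fun i k => ‖coherentCoeff (α i) k‖ ^ 2)).symm
    _ ≤ 1 := Finset.prod_le_one (fun i _ => Finset.sum_nonneg fun k _ => sq_nonneg _)
        fun i _ => sum_le_hasSum _ (fun k _ => sq_nonneg _) (hasSum_norm_coherentCoeff_sq _)

/-- The multi-mode coherent state `|α⟩ = ⨂ᵢ |αᵢ⟩`. -/
def coherentState {ι : Type*} [Fintype ι] (α : ι → ℂ) : FockSpace ι :=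
  ⟨fun n => ∏ i, coherentCoeff (α i) (n i), memℓp_coherent α⟩

/-- The trace of an operator, computed in the Fock basis. -/
def fockTrace {ι : Type*} (A : FockSpace ι →L[ℂ] FockSpace ι) : ℂ :=
  ∑' n : ι → ℕ, inner ℂ (fockState n) (A (fockState n))

/-! ### The pure-loss channel

The single-mode pure-loss channel of transmissivity (reflectivity) `r` has the Kraus operators
`A_l = ∑ₙ √(C(n+l,l)) √r ^ n √(1-r) ^ l |n⟩⟨n+l|`, `l : ℕ`  (`l` photons are lost). -/

/-- The matrix element `⟨n|A_l|n+l⟩` for one mode. -/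
def lossWeight (r : unitInterval) (l n : ℕ) : ℝ :=
  Real.sqrt ((n + l).choose l) * Real.sqrt r ^ n * Real.sqrt (1 - r) ^ l

theorem lossWeight_nonneg (r : unitInterval) (l n : ℕ) : 0 ≤ lossWeight r l n := by
  unfold lossWeight; positivity

theorem lossWeight_le_one (r : unitInterval) (l n : ℕ) : lossWeight r l n ≤ 1 := by
  have h0 : (0 : ℝ) ≤ r := r.2.1
  have h1 : (0 : ℝ) ≤ 1 - r := sub_nonneg.2 r.2.2
  have hsq : lossWeight r l n ^ 2 = (r : ℝ) ^ n * (1 - r) ^ l * ((n + l).choose l) := by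
    rw [lossWeight, mul_pow, mul_pow, Real.sq_sqrt (Nat.cast_nonneg _), ← pow_mul, ← pow_mul,
      mul_comm n 2, mul_comm l 2, pow_mul, pow_mul, Real.sq_sqrt h0, Real.sq_sqrt h1]
    ring
  have hbin : (r : ℝ) ^ n * (1 - r) ^ l * ((n + l).choose l) ≤ 1 := by
    have h := add_pow (r : ℝ) (1 - r) (n + l)
    rw [add_sub_cancel, one_pow] at h
    refine le_trans ?_ h.ge
    have := Finset.single_le_sum
      (f := fun k => (r : ℝ) ^ k * (1 - r) ^ (n + l - k) * ((n + l).choose k))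
      (s := Finset.range (n + l + 1)) (fun k _ => by positivity)
      (Finset.mem_range.2 (by omega : n < n + l + 1))
    simpa [Nat.choose_symm_add] using this
  exact (sq_le_one_iff₀ (lossWeight_nonneg r l n)).1 (hsq ▸ hbin)

theorem norm_prod_lossWeight_le_one {ι : Type*} [Fintype ι] (r : ι → unitInterval)
    (l n : ι → ℕ) : ‖((∏ i, lossWeight (r i) (l i) (n i) : ℝ) : ℂ)‖ ≤ 1 := by
  rw [Complex.norm_real, Real.norm_of_nonneg
    (Finset.prod_nonneg fun i _ => lossWeight_nonneg _ _ _)]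
  exact Finset.prod_le_one (fun i _ => lossWeight_nonneg _ _ _) fun i _ => lossWeight_le_one _ _ _

theorem summable_lossKraus {ι : Type*} [Fintype ι] (r : ι → unitInterval)
    (l : ι → ℕ) (x : FockSpace ι) :
    Summable (fun n : ι → ℕ => ‖x (n + l)‖ ^ 2) ∧
    (∀ n : ι → ℕ, ‖((∏ i, lossWeight (r i) (l i) (n i) : ℝ) : ℂ) * x (n + l)‖ ^ 2
      ≤ ‖x (n + l)‖ ^ 2) := by
  constructor
  · have hx : Summable (fun n : ι → ℕ => ‖x n‖ ^ 2) := by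
      simpa using (lp.memℓp x).summable (by norm_num)
    exact hx.comp_injective (add_left_injective l)
  · intro n
    rw [norm_mul]
    gcongr
    exact mul_le_of_le_one_left (norm_nonneg _) (norm_prod_lossWeight_le_one r l n)

theorem memℓp_lossKraus {ι : Type*} [Fintype ι] (r : ι → unitInterval)
    (l : ι → ℕ) (x : FockSpace ι) :
    Memℓp (fun n : ι → ℕ =>
      ((∏ i, lossWeight (r i) (l i) (n i) : ℝ) : ℂ) * x (n + l)) 2 := by
  obtain ⟨h1, h2⟩ := summable_lossKraus r l x
  refine memℓp_gen ?_
  simpa using Summable.of_nonneg_of_le (fun n => sq_nonneg _) h2 h1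

/-- The Kraus operator `⨂ᵢ A_{lᵢ}` of the product of the pure-loss channels of reflectivities
`rᵢ`: it maps `|n⟩` to `(∏ᵢ ⟨nᵢ-lᵢ|A_{lᵢ}|nᵢ⟩) |n-l⟩` if `l ≤ n`, and to `0` otherwise. -/
def lossKraus {ι : Type*} [Fintype ι] (r : ι → unitInterval) (l : ι → ℕ) :
    FockSpace ι →L[ℂ] FockSpace ι :=
  LinearMap.mkContinuous
    { toFun := fun x => ⟨fun n : ι → ℕ =>
        ((∏ i, lossWeight (r i) (l i) (n i) : ℝ) : ℂ) * x (n + l), memℓp_lossKraus r l x⟩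
      map_add' := fun x y => by
        ext n
        exact mul_add _ _ _
      map_smul' := fun c x => by
        ext n
        simp [mul_left_comm] }
    1 (fun x => by
      obtain ⟨h1, h2⟩ := summable_lossKraus r l x
      have hx : Summable (fun n : ι → ℕ => ‖x n‖ ^ 2) := by
        simpa using (lp.memℓp x).summable (by norm_num)
      rw [one_mul]
      refine lp.norm_le_of_tsum_le (by norm_num) (norm_nonneg _) ?_
      have hn : ‖x‖ ^ 2 = ∑' n, ‖x n‖ ^ 2 := by
        simpa using lp.norm_rpow_eq_tsum (p := 2) (by norm_num) x
      have key : ∑' n : ι → ℕ, ‖((∏ i, lossWeight (r i) (l i) (n i) : ℝ) : ℂ) * x (n + l)‖ ^ 2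
          ≤ ‖x‖ ^ 2 := by
        rw [hn]
        refine ((Summable.of_nonneg_of_le (fun n => sq_nonneg _) h2 h1).tsum_le_tsum h2 h1).trans ?_
        exact tsum_comp_le_tsum_of_inj hx (fun n => sq_nonneg _) (add_left_injective l)
      simpa using key)

/-- The product channel `⨂ᵢ 𝓛_{rᵢ}` of single-mode pure-loss channels,
`ρ ↦ ∑_l A_l ρ A_l†`. -/
def lossChannel {ι : Type*} [Fintype ι] (r : ι → unitInterval)
    (ρ : FockSpace ι →L[ℂ] FockSpace ι) : FockSpace ι →L[ℂ] FockSpace ι :=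
  ∑' l : ι → ℕ, lossKraus r l ∘L ρ ∘L ContinuousLinearMap.adjoint (lossKraus r l)

/-! ### Position-based reading of `m` cells with `K` modes per cell -/

/-- Operators on the `K` modes of each of the `m` cells; the mode `j` of cell `k` is `(k, j)`. -/
abbrev CellOperator (m K : ℕ) := FockSpace (Fin m × Fin K) →L[ℂ] FockSpace (Fin m × Fin K)

/-- The global channel `𝓔ₙ`: the target channel `𝓛_{r_T}^{⊗K}` acts on cell `n`, the background
channel `𝓛_{r_B}^{⊗K}` on all the other cells. -/
def cellChannel {m K : ℕ} (rB rT : unitInterval) (n : Fin m) (ρ : CellOperator m K) :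
    CellOperator m K :=
  lossChannel (fun i : Fin m × Fin K => if i.1 = n then rT else rB) ρ

/-- A POVM with outcomes `Fin m`. -/
def IsPOVM {m K : ℕ} (P : Fin m → CellOperator m K) : Prop :=
  (∀ n, (P n).IsPositive) ∧ ∑ n, P n = 1

/-- Mean error probability `1 - ∑ₙ (1/m) Tr[𝓔ₙ(ρ) Pₙ]` with input `ρ` and measurement `P`,
all positions of the target cell being equally likely. -/
def errorProb {m K : ℕ} (rB rT : unitInterval) (ρ : CellOperator m K)
    (P : Fin m → CellOperator m K) : ℝ :=
  1 - ∑ n, (1 / (m : ℝ)) * (fockTrace (cellChannel rB rT n ρ ∘L P n)).re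

/-- The error probabilities achievable with input `ρ`. -/
def errorProbs {m K : ℕ} (rB rT : unitInterval) (ρ : CellOperator m K) : Set ℝ :=
  {p | ∃ P : Fin m → CellOperator m K, IsPOVM P ∧ p = errorProb rB rT ρ P}

/-- The Helstrom limit for input `ρ`: the error probability minimized over the measurements. -/
def minErrorProb {m K : ℕ} (rB rT : unitInterval) (ρ : CellOperator m K) : ℝ :=
  sInf (errorProbs rB rT ρ)

/-- The pure state `⨂ₖ |α⟩_{Sₖ}` (as a density operator): every cell is irradiated by the same
`K`-mode coherent state `|α⟩ = ⨂ⱼ |αⱼ⟩`. -/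
def gusCoherent (m : ℕ) {K : ℕ} (α : EuclideanSpace ℂ (Fin K)) : CellOperator m K :=
  InnerProductSpace.rankOne ℂ (coherentState fun i : Fin m × Fin K => α i.2)
    (coherentState fun i : Fin m × Fin K => α i.2)

/-- The statistical mixture `∫ dν(α) ⨂ₖ |α⟩⟨α|_{Sₖ}`. -/
def gusMixture (m : ℕ) {K : ℕ} (ν : Measure (EuclideanSpace ℂ (Fin K))) : CellOperator m K :=
  ∫ α, gusCoherent m α ∂ν

/-- The mean number of photons irradiated over cell `k`, i.e. the expectation of the total
number operator of the modes of that cell. -/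
def meanPhotons {m K : ℕ} (ρ : CellOperator m K) (k : Fin m) : ℝ≥0∞ :=
  ∑' n : Fin m × Fin K → ℕ,
    ENNReal.ofReal ((∑ j, (n (k, j) : ℝ)) * (inner ℂ (fockState n) (ρ (fockState n))).re)

/-- The function `P_H(m, ζ) = ((m-1)/m²) [√(1+(m-1)ζ) - √(1-ζ)]²`. -/
def helstromPPM (m : ℕ) (ζ : ℝ) : ℝ :=
  ((m : ℝ) - 1) / (m : ℝ) ^ 2 * (Real.sqrt (1 + ((m : ℝ) - 1) * ζ) - Real.sqrt (1 - ζ)) ^ 2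

end

noncomputable section

open Filter Topology

/-! ### Discrimination of equidistant states -/

/-! Pure loss maps a coherent state to a damped coherent state, so a uniform coherent input yields
`m` pure outputs. Outputs for two different target positions differ in exactly two cells, so all
their overlaps equal one real number `ζ`, which decreases exponentially in `‖β‖ ^ 2`
(`inner_cellOutput`).

For such equidistant states the Gram matrix is `(1 - ζ) I + ζ J`, with `J` the all-ones matrix and
eigenvalues `t ^ 2 = 1 - ζ` and `s ^ 2 = 1 + (m - 1) ζ`. Its square root is `t I + b J` with `b = (s
- t) / m`. When `t > 0`, this means `ψ n = t • e n + b • F` with `e` orthonormal and `F = ∑ k, e k =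
(∑ k, ψ k) / s`. Measuring along `e` succeeds with probability `(t + b) ^ 2`
(`exists_povm_le_sum_re_inner`), and convexity of the quadratic forms of the POVM elements shows
that nothing does better (`sum_re_inner_le`).

For a mixture and a fixed POVM, the error is the `ν`-average of the errors of the pure inputs, each
at least `helstromPPM m (exp (-(‖β‖ ^ 2 * c)))` with `c = (√rB - √rT) ^ 2`. Jensen applied to the
convex `helstromPPM`, then to `exp`, together with monotonicity and the energy constraint, bounds
the average below (`helstromPPM_le_errorProb_gusMixture`). -/

/-- Jensen for the quadratic form of `P`: the right side minus the left side is `a * b` times the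
form at `x - y`. -/
theorem re_inner_combo_le {E : Type*} [NormedAddCommGroup E] [InnerProductSpace ℂ E]
    {P : E →L[ℂ] E} (hP : P.IsPositive) {a b : ℝ} (ha : 0 ≤ a) (hb : 0 ≤ b)
    (x y : E) :
    (inner ℂ ((a : ℂ) • x + (b : ℂ) • y) (P ((a : ℂ) • x + (b : ℂ) • y))).re
      ≤ (a + b) * (a * (inner ℂ x (P x)).re + b * (inner ℂ y (P y)).re) := by
  have h := mul_nonneg (mul_nonneg ha hb) (hP.re_inner_nonneg_right (x - y))
  simp only [map_sub, map_add, map_smul, inner_sub_left, inner_sub_right, inner_add_left,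
    inner_add_right, inner_smul_left, inner_smul_right, Complex.conj_ofReal,
    RCLike.re_eq_complex_re, Complex.add_re, Complex.re_ofReal_mul] at h ⊢
  linarith

theorem one_sub_sq_eq_helstromPPM {m : ℕ} (hm : 1 ≤ m) {ζ : ℝ} (h0 : 0 ≤ ζ) (h1 : ζ ≤ 1) :
    1 - (Real.sqrt (1 - ζ)
      + (Real.sqrt (1 + ((m : ℝ) - 1) * ζ) - Real.sqrt (1 - ζ)) / m) ^ 2 = helstromPPM m ζ := by
  have hm' : (1 : ℝ) ≤ m := by exact_mod_cast hm
  have hm0 : (m : ℝ) ≠ 0 := by positivity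
  have e1 := Real.sq_sqrt (show 0 ≤ 1 + ((m : ℝ) - 1) * ζ by nlinarith)
  have e2 := Real.sq_sqrt (show 0 ≤ 1 - ζ by linarith)
  unfold helstromPPM
  set s := Real.sqrt (1 + ((m : ℝ) - 1) * ζ)
  set t := Real.sqrt (1 - ζ)
  field_simp
  -- The trace of the Gram matrix, computed from its eigenvalues.
  have : (m : ℝ) = s ^ 2 + ((m : ℝ) - 1) * t ^ 2 := by rw [e1, e2]; ring
  linear_combination (m : ℝ) * this

section Equidistant

variable {E : Type*} [NormedAddCommGroup E] [InnerProductSpace ℂ E]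

theorem sum_inner_of_equidistant {m : ℕ} {ζ : ℝ} {ψ : Fin m → E}
    (hψ : ∀ i j, inner ℂ (ψ i) (ψ j) = if i = j then 1 else (ζ : ℂ)) (j : Fin m) :
    inner ℂ (∑ k, ψ k) (ψ j) = ((1 + ((m : ℝ) - 1) * ζ : ℝ) : ℂ) := by
  have : ∀ k, (if k = j then 1 else (ζ : ℂ)) = ζ + if k = j then 1 - (ζ : ℂ) else 0 := by
    intro k; split_ifs <;> ring
  simp only [sum_inner, hψ, this, Finset.sum_add_distrib]
  simp
  ring

theorem inner_sum_of_equidistant {m : ℕ} {ζ : ℝ} {ψ : Fin m → E}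
    (hψ : ∀ i j, inner ℂ (ψ i) (ψ j) = if i = j then 1 else (ζ : ℂ)) (j : Fin m) :
    inner ℂ (ψ j) (∑ k, ψ k) = ((1 + ((m : ℝ) - 1) * ζ : ℝ) : ℂ) := by
  rw [← inner_conj_symm, sum_inner_of_equidistant hψ, Complex.conj_ofReal]

theorem inner_sum_sum_of_equidistant {m : ℕ} {ζ : ℝ} {ψ : Fin m → E}
    (hψ : ∀ i j, inner ℂ (ψ i) (ψ j) = if i = j then 1 else (ζ : ℂ)) :
    inner ℂ (∑ k, ψ k) (∑ k, ψ k) = ((m * (1 + ((m : ℝ) - 1) * ζ) : ℝ) : ℂ) := by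
  rw [inner_sum, Finset.sum_congr rfl fun j _ => sum_inner_of_equidistant hψ j]
  simp
  ring

/-- Vectors with constant overlap `ζ`, after subtraction of a multiple of their sum, become
orthogonal. -/
theorem inner_sub_smul_sum {m : ℕ} (hm : 1 ≤ m) {ζ : ℝ} (h0 : 0 ≤ ζ) (h1 : ζ ≤ 1)
    (ψ : Fin m → E) (hψ : ∀ i j, inner ℂ (ψ i) (ψ j) = if i = j then 1 else (ζ : ℂ))
    {s t b : ℝ} (hs : s = Real.sqrt (1 + ((m : ℝ) - 1) * ζ)) (ht : t = Real.sqrt (1 - ζ))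
    (hb : b = (s - t) / m) (i j : Fin m) :
    inner ℂ (ψ i - ((b / s : ℝ) : ℂ) • ∑ k, ψ k) (ψ j - ((b / s : ℝ) : ℂ) • ∑ k, ψ k)
      = if i = j then ((t ^ 2 : ℝ) : ℂ) else 0 := by
  have hm' : (1 : ℝ) ≤ m := by exact_mod_cast hm
  have hpos : 0 < 1 + ((m : ℝ) - 1) * ζ := by nlinarith
  have hs0 : s ≠ 0 := by rw [hs]; positivity
  have e1 : s ^ 2 = 1 + ((m : ℝ) - 1) * ζ := by rw [hs]; exact Real.sq_sqrt hpos.le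
  have e2 : t ^ 2 = 1 - ζ := by rw [ht]; exact Real.sq_sqrt (by linarith)
  simp only [inner_sub_left, inner_sub_right, inner_smul_left, inner_smul_right, hψ,
    Complex.conj_ofReal, sum_inner_of_equidistant hψ, inner_sum_of_equidistant hψ,
    inner_sum_sum_of_equidistant hψ, ← e1]
  -- The off-diagonal entry `ζ - 2 b s + m b ^ 2` vanishes because `(s - m b) ^ 2 = t ^ 2` and `s ^
  -- 2 - t ^ 2 = m ζ`.
  have key : ζ - 2 * (b / s * s ^ 2) + (b / s) * ((b / s) * (m * s ^ 2)) = 0 := by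
    have hm0 : (m : ℝ) ≠ 0 := by positivity
    subst hb
    field_simp
    linear_combination e2 - e1
  split_ifs with h
  · rw [e2]
    have : (1 - 2 * (b / s * s ^ 2) + (b / s) * ((b / s) * (m * s ^ 2)) : ℝ) = 1 - ζ := by
      linarith
    rw [← this]; push_cast; ring
  · rw [← Complex.ofReal_zero, ← key]; push_cast; ring

/-- With `ψ n = t • e n + b • F`, convexity splits each term. The `e` part contributes at most 1 per
outcome, and the `F` parts add up to `‖F‖ ^ 2 = m`. -/
theorem sum_re_inner_le {m : ℕ} (hm : 1 ≤ m) {ζ : ℝ} (h0 : 0 ≤ ζ) (h1 : ζ ≤ 1)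
    (ψ : Fin m → E) (hψ : ∀ i j, inner ℂ (ψ i) (ψ j) = if i = j then 1 else (ζ : ℂ))
    (P : Fin m → E →L[ℂ] E) (hP : ∀ n, (P n).IsPositive) (hP1 : ∑ n, P n = 1) :
    ∑ n, (inner ℂ (ψ n) (P n (ψ n))).re ≤ m * (1 - helstromPPM m ζ) := by
  rw [← one_sub_sq_eq_helstromPPM hm h0 h1, sub_sub_cancel]
  obtain ⟨s, hs⟩ : ∃ s, s = Real.sqrt (1 + ((m : ℝ) - 1) * ζ) := ⟨_, rfl⟩
  obtain ⟨t, ht⟩ : ∃ t, t = Real.sqrt (1 - ζ) := ⟨_, rfl⟩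
  rw [← hs, ← ht]
  obtain ⟨b, hb⟩ : ∃ b, b = (s - t) / m := ⟨_, rfl⟩
  rw [← hb]
  have hm' : (1 : ℝ) ≤ m := by exact_mod_cast hm
  have hm0 : (m : ℝ) ≠ 0 := by positivity
  have hpos : 0 < 1 + ((m : ℝ) - 1) * ζ := by nlinarith
  have hs0 : 0 < s := by rw [hs]; positivity
  have ht0 : 0 ≤ t := by rw [ht]; positivity
  have hts : t ≤ s := by
    rw [hs, ht]; apply Real.sqrt_le_sqrt; nlinarith
  have hb0 : 0 ≤ b := by rw [hb]; exact div_nonneg (by linarith) (by linarith)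
  have hG := inner_sub_smul_sum hm h0 h1 ψ hψ hs ht hb
  set Ψ := ∑ k, ψ k with hΨ
  set F : E := ((1 / s : ℝ) : ℂ) • Ψ with hF
  -- For `t = 0` the inverse is `0`, so `e n = 0`. Only `‖e n‖ ≤ 1` is used below, hence no separate
  -- case for `ζ = 1`.
  set e : Fin m → E := fun n => ((t⁻¹ : ℝ) : ℂ) • (ψ n - ((b / s : ℝ) : ℂ) • Ψ) with he
  have hnorm : ∀ n, ‖ψ n - ((b / s : ℝ) : ℂ) • Ψ‖ ^ 2 = t ^ 2 := by
    intro n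
    have := hG n n
    rw [if_pos rfl] at this
    rw [← inner_self_eq_norm_sq (𝕜 := ℂ), this]
    exact Complex.ofReal_re _
  have hnorm' : ∀ n, ‖ψ n - ((b / s : ℝ) : ℂ) • Ψ‖ = t := fun n =>
    (pow_left_inj₀ (norm_nonneg _) ht0 two_ne_zero).1 (hnorm n)
  have hdec : ∀ n, ψ n = (t : ℂ) • e n + (b : ℂ) • F := by
    intro n
    have e1 : (b : ℂ) • F = ((b / s : ℝ) : ℂ) • Ψ := by
      rw [hF, smul_smul]; congr 1; push_cast; ring
    have e2 : (t : ℂ) • e n = ψ n - ((b / s : ℝ) : ℂ) • Ψ := by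
      by_cases h : t = 0
      · have := hnorm' n
        rw [h, norm_eq_zero] at this
        rw [this, h]; simp
      · rw [he, smul_smul, ← Complex.ofReal_mul, mul_inv_cancel₀ h, Complex.ofReal_one, one_smul]
    rw [e1, e2, sub_add_cancel]
  have hen : ∀ n, ‖e n‖ ≤ 1 := by
    intro n
    rw [he, norm_smul, hnorm', Complex.norm_real, Real.norm_of_nonneg (by positivity)]
    exact inv_mul_le_one
  have hF2 : ‖F‖ ^ 2 = m := by
    have : ‖Ψ‖ ^ 2 = m * s ^ 2 := by
      rw [← inner_self_eq_norm_sq (𝕜 := ℂ), inner_sum_sum_of_equidistant hψ, hs, Real.sq_sqrt hpos.le]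
      exact Complex.ofReal_re _
    rw [hF, norm_smul, mul_pow, this, Complex.norm_real, Real.norm_of_nonneg (by positivity)]
    field_simp
  have hsum : ∀ x : E, ∑ n, (inner ℂ x (P n x)).re = ‖x‖ ^ 2 := by
    intro x
    rw [← Complex.re_sum, ← inner_sum, ← sum_apply, hP1]
    simpa using inner_self_eq_norm_sq (𝕜 := ℂ) x
  have hone : ∀ n, (inner ℂ (e n) (P n (e n))).re ≤ 1 := by
    intro n
    refine (Finset.single_le_sum (f := fun k => (inner ℂ (e n) (P k (e n))).re)
      (fun k _ => (hP k).re_inner_nonneg_right _) (Finset.mem_univ n)).trans ?_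
    rw [hsum]
    exact pow_le_one₀ (norm_nonneg _) (hen n)
  calc ∑ n, (inner ℂ (ψ n) (P n (ψ n))).re
      ≤ ∑ n, (t + b) * (t * 1 + b * (inner ℂ F (P n F)).re) := by
        refine Finset.sum_le_sum fun n _ => ?_
        rw [hdec n]
        refine (re_inner_combo_le (hP n) ht0 hb0 _ _).trans ?_
        gcongr
        exact hone n
    _ = m * (t + b) ^ 2 := by
        rw [← Finset.mul_sum, Finset.sum_add_distrib, ← Finset.mul_sum _ _ b, hsum, hF2]
        simp
        ring

theorem exists_povm_le_sum_re_inner [CompleteSpace E] {m : ℕ} (hm : 1 ≤ m) {ζ : ℝ} (h0 : 0 ≤ ζ) (h1 : ζ ≤ 1)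
    (ψ : Fin m → E) (hψ : ∀ i j, inner ℂ (ψ i) (ψ j) = if i = j then 1 else (ζ : ℂ)) :
    ∃ P : Fin m → E →L[ℂ] E, (∀ n, (P n).IsPositive) ∧ ∑ n, P n = 1 ∧
      m * (1 - helstromPPM m ζ) ≤ ∑ n, (inner ℂ (ψ n) (P n (ψ n))).re := by
  rw [← one_sub_sq_eq_helstromPPM hm h0 h1, sub_sub_cancel]
  obtain ⟨s, hs⟩ : ∃ s, s = Real.sqrt (1 + ((m : ℝ) - 1) * ζ) := ⟨_, rfl⟩
  obtain ⟨t, ht⟩ : ∃ t, t = Real.sqrt (1 - ζ) := ⟨_, rfl⟩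
  rw [← hs, ← ht]
  obtain ⟨b, hb⟩ : ∃ b, b = (s - t) / m := ⟨_, rfl⟩
  rw [← hb]
  have hm' : (1 : ℝ) ≤ m := by exact_mod_cast hm
  have hm0 : (m : ℝ) ≠ 0 := by positivity
  have hpos : 0 < 1 + ((m : ℝ) - 1) * ζ := by nlinarith
  have hs0 : 0 < s := by rw [hs]; positivity
  have ht0 : 0 ≤ t := by rw [ht]; positivity
  have e1 : s ^ 2 = 1 + ((m : ℝ) - 1) * ζ := by rw [hs]; exact Real.sq_sqrt hpos.le
  have e2 : t ^ 2 = 1 - ζ := by rw [ht]; exact Real.sq_sqrt (by linarith)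
  let i0 : Fin m := ⟨0, hm⟩
  rcases ht0.eq_or_lt with h | htpos
  -- All the states coincide up to a null vector, so always guessing `i0` is optimal.
  · have hζ : ζ = 1 := by rw [← h] at e2; linarith
    refine ⟨Pi.single i0 1, fun n => ?_, by simp, ?_⟩
    · rcases eq_or_ne n i0 with rfl | hn
      · simp
      · simp [hn]
    · rw [Finset.sum_eq_single i0 (fun n _ hn => by simp [hn]) (by simp)]
      simp only [Pi.single_eq_same, one_apply_eq_self, hψ, if_true, Complex.one_re]
      rw [hb, ← h, zero_add, sub_zero, div_pow, e1, hζ]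
      field_simp
      linarith
  · have hG := inner_sub_smul_sum hm h0 h1 ψ hψ hs ht hb
    set Ψ := ∑ k, ψ k with hΨ
    set e : Fin m → E := fun n => ((t⁻¹ : ℝ) : ℂ) • (ψ n - ((b / s : ℝ) : ℂ) • Ψ) with he
    have hon : Orthonormal ℂ e := by
      rw [orthonormal_iff_ite]
      intro i j
      simp only [he, inner_smul_left, inner_smul_right, hG, Complex.conj_ofReal]
      split_ifs
      · norm_cast; field_simp
      · simp
    have hover : ∀ n, inner ℂ (e n) (ψ n) = ((t + b : ℝ) : ℂ) := by
      intro n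
      simp only [he, inner_smul_left, inner_sub_left, hψ, hΨ, sum_inner_of_equidistant hψ, ← e1, if_true,
        Complex.conj_ofReal]
      have : t⁻¹ * (1 - b / s * s ^ 2) = t + b := by
        rw [hb]; field_simp
        linear_combination (-(m : ℝ) + 1) * e2 - e1
      rw [← this]; push_cast; ring
    -- Projection onto the complement of the span of `e`. It completes the measurement and can be
    -- assigned to any outcome. Its positivity is Bessel's inequality.
    set R : E →L[ℂ] E := 1 - ∑ k, InnerProductSpace.rankOne ℂ (e k) (e k) with hR
    have hSpos : (∑ k, InnerProductSpace.rankOne ℂ (e k) (e k)).IsPositive :=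
      ContinuousLinearMap.isPositive_sum _ fun k _ => InnerProductSpace.isPositive_rankOne_self _
    have hRpos : R.IsPositive := by
      refine ContinuousLinearMap.isPositive_def'.2
        ⟨(ContinuousLinearMap.isPositive_one.isSelfAdjoint).sub hSpos.isSelfAdjoint, fun x => ?_⟩
      have := hon.sum_inner_products_le x (s := Finset.univ)
      have hx : (inner ℂ (R x) x).re = ‖x‖ ^ 2 - ∑ k, ‖inner ℂ (e k) x‖ ^ 2 := by
        rw [hR, sub_apply, inner_sub_left, Complex.sub_re]
        congr 1
        · simpa using inner_self_eq_norm_sq (𝕜 := ℂ) x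
        · rw [sum_apply, sum_inner, Complex.re_sum]
          refine Finset.sum_congr rfl fun k _ => ?_
          rw [InnerProductSpace.rankOne_apply, inner_smul_left, RCLike.conj_mul]
          norm_cast
      change 0 ≤ (inner ℂ (R x) x).re
      rw [hx]; linarith
    refine ⟨fun n => InnerProductSpace.rankOne ℂ (e n) (e n) + if n = i0 then R else 0,
      fun n => ?_, ?_, ?_⟩
    · refine (InnerProductSpace.isPositive_rankOne_self _).add ?_
      split_ifs
      · exact hRpos
      · exact ContinuousLinearMap.isPositive_zero
    · rw [Finset.sum_add_distrib]
      simp [hR]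
    · calc (m : ℝ) * (t + b) ^ 2 = ∑ n : Fin m, (t + b) ^ 2 := by simp
        _ ≤ _ := by
          refine Finset.sum_le_sum fun n _ => ?_
          rw [add_apply, inner_add_right, Complex.add_re]
          have h1 : (inner ℂ (ψ n) (InnerProductSpace.rankOne ℂ (e n) (e n) (ψ n))).re
              = (t + b) ^ 2 := by
            rw [InnerProductSpace.rankOne_apply, inner_smul_right, ← inner_conj_symm (ψ n) (e n),
              hover, Complex.conj_ofReal]
            norm_cast
            ring
          have h2 : 0 ≤ (inner ℂ (ψ n) ((if n = i0 then R else 0) (ψ n))).re := by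
            split_ifs
            · exact hRpos.re_inner_nonneg_right _
            · simp
          linarith

end Equidistant

/-! ### Convexity and monotonicity of `helstromPPM` -/

/-- Expanding the square leaves an affine function minus a multiple of a geometric mean of two
affine functions, from which convexity can be read off. -/
theorem helstromPPM_eq {m : ℕ} (hm : 1 ≤ m) {ζ : ℝ} (h0 : 0 ≤ ζ) (h1 : ζ ≤ 1) :
    helstromPPM m ζ = ((m : ℝ) - 1) / (m : ℝ) ^ 2 * (2 + ((m : ℝ) - 2) * ζ
      - 2 * (Real.sqrt (1 + ((m : ℝ) - 1) * ζ) * Real.sqrt (1 - ζ))) := by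
  have hm' : (1 : ℝ) ≤ m := by exact_mod_cast hm
  have e1 := Real.sq_sqrt (show 0 ≤ 1 + ((m : ℝ) - 1) * ζ by nlinarith)
  have e2 := Real.sq_sqrt (show 0 ≤ 1 - ζ by linarith)
  unfold helstromPPM
  congr 1
  linear_combination e1 + e2

theorem helstromPPM_nonneg {m : ℕ} (hm : 1 ≤ m) (ζ : ℝ) : 0 ≤ helstromPPM m ζ := by
  have hm' : (1 : ℝ) ≤ m := by exact_mod_cast hm
  exact mul_nonneg (div_nonneg (by linarith) (by positivity)) (sq_nonneg _)

theorem helstromPPM_mono {m : ℕ} (hm : 1 ≤ m) {x y : ℝ} (h0 : 0 ≤ x) (hxy : x ≤ y) :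
    helstromPPM m x ≤ helstromPPM m y := by
  have hm' : (1 : ℝ) ≤ m := by exact_mod_cast hm
  unfold helstromPPM
  have h1 : Real.sqrt (1 - x) ≤ Real.sqrt (1 + ((m : ℝ) - 1) * x) :=
    Real.sqrt_le_sqrt (by nlinarith)
  have h2 : Real.sqrt (1 - y) ≤ Real.sqrt (1 - x) := Real.sqrt_le_sqrt (by linarith)
  have h3 : Real.sqrt (1 + ((m : ℝ) - 1) * x) ≤ Real.sqrt (1 + ((m : ℝ) - 1) * y) :=
    Real.sqrt_le_sqrt (by nlinarith)
  refine mul_le_mul_of_nonneg_left ?_ (div_nonneg (by linarith) (by positivity))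
  exact pow_le_pow_left₀ (by linarith) (by linarith) 2

theorem helstromPPM_convexOn {m : ℕ} (hm : 1 ≤ m) :
    ConvexOn ℝ (Set.Icc 0 1) (helstromPPM m) := by
  have hm' : (1 : ℝ) ≤ m := by exact_mod_cast hm
  refine ⟨convex_Icc 0 1, fun x hx y hy a b ha hb hab => ?_⟩
  have hz := convex_Icc (0 : ℝ) 1 hx hy ha hb hab
  simp only [smul_eq_mul] at hz ⊢
  rw [helstromPPM_eq hm hx.1 hx.2, helstromPPM_eq hm hy.1 hy.2, helstromPPM_eq hm hz.1 hz.2]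
  have x1 := Real.sq_sqrt (show 0 ≤ 1 + ((m : ℝ) - 1) * x by nlinarith [hx.1])
  have x2 := Real.sq_sqrt (show 0 ≤ 1 - x by linarith [hx.2])
  have y1 := Real.sq_sqrt (show 0 ≤ 1 + ((m : ℝ) - 1) * y by nlinarith [hy.1])
  have y2 := Real.sq_sqrt (show 0 ≤ 1 - y by linarith [hy.2])
  -- Concavity of the geometric mean, by Cauchy-Schwarz: the defect of the squares is `a * b * (p *
  -- v - q * u) ^ 2`.
  have key : a * (Real.sqrt (1 + ((m : ℝ) - 1) * x) * Real.sqrt (1 - x))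
      + b * (Real.sqrt (1 + ((m : ℝ) - 1) * y) * Real.sqrt (1 - y))
      ≤ Real.sqrt (1 + ((m : ℝ) - 1) * (a * x + b * y)) * Real.sqrt (1 - (a * x + b * y)) := by
    rw [← Real.sqrt_mul (show 0 ≤ 1 + ((m : ℝ) - 1) * (a * x + b * y) by nlinarith [hz.1])]
    apply Real.le_sqrt_of_sq_le
    have c1 : 1 + ((m : ℝ) - 1) * (a * x + b * y)
        = a * Real.sqrt (1 + ((m : ℝ) - 1) * x) ^ 2
          + b * Real.sqrt (1 + ((m : ℝ) - 1) * y) ^ 2 := by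
      rw [x1, y1]; linear_combination -hab
    have c2 : 1 - (a * x + b * y)
        = a * Real.sqrt (1 - x) ^ 2 + b * Real.sqrt (1 - y) ^ 2 := by
      rw [x2, y2]; linear_combination -hab
    rw [c1, c2]
    set p := Real.sqrt (1 + ((m : ℝ) - 1) * x)
    set q := Real.sqrt (1 - x)
    set u := Real.sqrt (1 + ((m : ℝ) - 1) * y)
    set v := Real.sqrt (1 - y)
    nlinarith [mul_nonneg (mul_nonneg ha hb) (sq_nonneg (p * v - q * u))]
  have hc : 0 ≤ ((m : ℝ) - 1) / (m : ℝ) ^ 2 := div_nonneg (by linarith) (by positivity)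
  nlinarith [mul_le_mul_of_nonneg_left key hc]

theorem continuous_helstromPPM (m : ℕ) : Continuous (helstromPPM m) := by
  unfold helstromPPM; fun_prop

/-! ### Sums over occupation numbers -/

/-- Every finite set of occupation numbers lies in a box, on which the sum of products factorizes.
This gives absolute summability, and the value is then the limit along the cofinal boxes `range N`.
-/
theorem hasSum_prod_pi {ι 𝕜 : Type*} [Fintype ι] [NormedField 𝕜] [CompleteSpace 𝕜]
    {f : ι → ℕ → 𝕜} {a : ι → 𝕜} (hf : ∀ i, HasSum (f i) (a i))
    (hn : ∀ i, Summable fun k => ‖f i k‖) :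
    HasSum (fun n : ι → ℕ => ∏ i, f i (n i)) (∏ i, a i) := by
  classical
  have hs : Summable fun n : ι → ℕ => ∏ i, f i (n i) := by
    refine Summable.of_norm ?_
    simp only [norm_prod]
    refine summable_of_sum_le (c := ∏ i, ∑' k, ‖f i k‖)
      (fun n => Finset.prod_nonneg fun i _ => norm_nonneg _) fun s => ?_
    have hsub : s ⊆ Fintype.piFinset fun i => s.image fun n => n i := fun n hn =>
      Fintype.mem_piFinset.2 fun i => Finset.mem_image_of_mem _ hn
    refine (Finset.sum_le_sum_of_subset_of_nonneg hsub
      fun n _ _ => Finset.prod_nonneg fun i _ => norm_nonneg _).trans ?_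
    rw [← Finset.prod_univ_sum (fun i => s.image fun n => n i) (fun i k => ‖f i k‖)]
    exact Finset.prod_le_prod (fun i _ => Finset.sum_nonneg fun k _ => norm_nonneg _)
      fun i _ => (hn i).sum_le_tsum _ fun k _ => norm_nonneg _
  have hT : Tendsto (fun N : ℕ => Fintype.piFinset fun _ : ι => Finset.range N) atTop atTop := by
    refine tendsto_atTop_finset_of_monotone
      (fun N M h => Fintype.piFinset_subset _ _ fun _ => Finset.range_subset_range.2 h) fun n => ?_
    refine ⟨(Finset.univ.sup n) + 1, Fintype.mem_piFinset.2 fun i => Finset.mem_range.2 ?_⟩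
    exact Nat.lt_succ_of_le (Finset.le_sup (f := n) (Finset.mem_univ i))
  have h1 := hs.hasSum.comp hT
  have h2 : Tendsto (fun N : ℕ => ∏ i, ∑ k ∈ Finset.range N, f i k) atTop (𝓝 (∏ i, a i)) :=
    tendsto_finsetProd _ fun i _ => (hf i).tendsto_sum_nat
  have h3 : (∑' n : ι → ℕ, ∏ i, f i (n i)) = ∏ i, a i := by
    refine tendsto_nhds_unique h1 (h2.congr fun N => ?_)
    exact Finset.prod_univ_sum (fun _ => Finset.range N) f
  rw [← h3]
  exact hs.hasSum

/-! ### Coherent states -/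

theorem hasSum_conj_coherentCoeff_mul (α β : ℂ) :
    HasSum (fun n => inner ℂ (coherentCoeff α n) (coherentCoeff β n))
      (Complex.exp (-(‖α‖ : ℂ) ^ 2 / 2 - (‖β‖ : ℂ) ^ 2 / 2 + (starRingEnd ℂ) α * β)) := by
  have h := (NormedSpace.expSeries_div_hasSum_exp ((starRingEnd ℂ) α * β)).mul_left
    (Complex.exp (-(‖α‖ : ℂ) ^ 2 / 2 - (‖β‖ : ℂ) ^ 2 / 2))
  rw [← Complex.exp_eq_exp_ℂ, ← Complex.exp_add] at h
  refine h.congr_fun ?_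
  intro n
  have hf : ((Real.sqrt n.factorial : ℝ) : ℂ) * (Real.sqrt n.factorial : ℝ) = n.factorial := by
    norm_cast; exact_mod_cast Real.mul_self_sqrt (Nat.cast_nonneg _)
  have hf0 : ((Real.sqrt n.factorial : ℝ) : ℂ) ≠ 0 := by
    norm_cast; positivity
  rw [RCLike.inner_apply, coherentCoeff, coherentCoeff, ← hf]
  simp only [map_div₀, map_mul, map_pow, Complex.conj_ofReal]
  rw [sub_eq_add_neg, Complex.exp_add]
  push_cast
  rw [neg_div (2 : ℂ) ((‖β‖ : ℂ) ^ 2)]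
  field_simp
  rw [mul_pow, mul_comm]

theorem inner_coherentState {ι : Type*} [Fintype ι] (α β : ι → ℂ) :
    inner ℂ (coherentState α) (coherentState β)
      = Complex.exp (∑ i, (-(‖α i‖ : ℂ) ^ 2 / 2 - (‖β i‖ : ℂ) ^ 2 / 2
        + (starRingEnd ℂ) (α i) * β i)) := by
  rw [Complex.exp_sum]
  refine (lp.hasSum_inner (coherentState α) (coherentState β)).unique ?_
  have h := hasSum_prod_pi (fun i => hasSum_conj_coherentCoeff_mul (α i) (β i)) fun i =>
    (hasSum_conj_coherentCoeff_mul (α i) (β i)).summable.norm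
  refine h.congr_fun fun n => ?_
  simp [coherentState, RCLike.inner_apply, Finset.prod_mul_distrib, map_prod]

theorem norm_coherentState {ι : Type*} [Fintype ι] (α : ι → ℂ) : ‖coherentState α‖ = 1 := by
  have h := inner_coherentState α α
  have : ∀ i, -(‖α i‖ : ℂ) ^ 2 / 2 - (‖α i‖ : ℂ) ^ 2 / 2 + (starRingEnd ℂ) (α i) * α i = 0 := by
    intro i
    rw [Complex.conj_mul']
    ring
  simp only [this, Finset.sum_const_zero, Complex.exp_zero] at h
  rw [inner_self_eq_norm_sq_to_K] at h
  have h' : ‖coherentState α‖ ^ 2 = 1 := by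
    have := congrArg Complex.re h
    simpa [← Complex.ofReal_pow] using this
  exact (pow_eq_one_iff_of_nonneg (norm_nonneg _) two_ne_zero).1 h'

/-- For unit vectors the squared distance is `2 - 2 Re ⟨x, y⟩`, and the overlap is an explicit
exponential. -/
theorem continuous_coherentState {ι : Type*} [Fintype ι] :
    Continuous (coherentState : (ι → ℂ) → FockSpace ι) := by
  rw [continuous_iff_continuousAt]
  intro α
  rw [ContinuousAt, tendsto_iff_norm_sub_tendsto_zero]
  have hsq : Tendsto (fun β : ι → ℂ => ‖coherentState β - coherentState α‖ ^ 2) (𝓝 α) (𝓝 0) := by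
    have hc : Continuous fun β : ι → ℂ =>
        2 - 2 * (inner ℂ (coherentState β) (coherentState α)).re := by
      simp only [inner_coherentState]
      fun_prop
    have h0 : 2 - 2 * (inner ℂ (coherentState α) (coherentState α)).re = 0 := by
      rw [inner_self_eq_norm_sq_to_K, norm_coherentState]; norm_num
    have := hc.tendsto α
    rw [h0] at this
    refine this.congr fun β => ?_
    rw [@norm_sub_sq ℂ, norm_coherentState, norm_coherentState]
    simp only [RCLike.re_eq_complex_re]
    ring
  have := (Real.continuous_sqrt.tendsto 0).comp hsq
  rw [Real.sqrt_zero] at this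
  refine this.congr fun β => ?_
  exact Real.sqrt_sq (norm_nonneg _)

/-! ### Coherent states under pure loss -/

/-- The beam-splitter picture: the amplitude divides into a lost part `√(1 - r) α` and a reflected
part `√r α`, in a product state. -/
theorem lossWeight_mul_coherentCoeff (r : unitInterval) (α : ℂ) (l n : ℕ) :
    (lossWeight r l n : ℂ) * coherentCoeff α (n + l)
      = coherentCoeff ((Real.sqrt (1 - r) : ℝ) * α) l
        * coherentCoeff ((Real.sqrt r : ℝ) * α) n := by
  have h0 : (0 : ℝ) ≤ r := r.2.1
  have h1 : (0 : ℝ) ≤ 1 - r := sub_nonneg.2 r.2.2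
  have hexp : Real.exp (-‖α‖ ^ 2 / 2) = Real.exp (-‖(Real.sqrt (1 - r) : ℝ) * α‖ ^ 2 / 2)
      * Real.exp (-‖(Real.sqrt r : ℝ) * α‖ ^ 2 / 2) := by
    rw [← Real.exp_add]
    congr 1
    rw [norm_mul, norm_mul, mul_pow, mul_pow, Complex.norm_real, Complex.norm_real,
      Real.norm_of_nonneg (Real.sqrt_nonneg _), Real.norm_of_nonneg (Real.sqrt_nonneg _),
      Real.sq_sqrt h0, Real.sq_sqrt h1]
    ring
  have hch : Real.sqrt ((n + l).factorial) = Real.sqrt ((n + l).choose l)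
      * (Real.sqrt l.factorial * Real.sqrt n.factorial) := by
    rw [← Real.sqrt_mul (Nat.cast_nonneg _), ← Real.sqrt_mul (Nat.cast_nonneg _)]
    congr 1
    have := Nat.add_choose_mul_factorial_mul_factorial l n
    rw [add_comm l n, Nat.choose_symm_add] at this
    rw [← this]; push_cast; ring
  have hc : Real.sqrt ((n + l).choose l) ≠ 0 := by
    have : 0 < (n + l).choose l := Nat.choose_pos (by omega)
    positivity
  have hl : Real.sqrt l.factorial ≠ 0 := by positivity
  have hn : Real.sqrt n.factorial ≠ 0 := by positivity
  rw [lossWeight, coherentCoeff, coherentCoeff, coherentCoeff, hexp, hch]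
  have hc' := Complex.ofReal_ne_zero.2 hc
  have hl' := Complex.ofReal_ne_zero.2 hl
  have hn' := Complex.ofReal_ne_zero.2 hn
  push_cast
  field_simp
  ring

theorem lossKraus_coherentState {ι : Type*} [Fintype ι] (r : ι → unitInterval) (l : ι → ℕ)
    (α : ι → ℂ) :
    lossKraus r l (coherentState α)
      = coherentState (fun i => (Real.sqrt (1 - r i) : ℝ) * α i) l
        • coherentState (fun i => (Real.sqrt (r i) : ℝ) * α i) := by
  ext n
  change ((∏ i, lossWeight (r i) (l i) (n i) : ℝ) : ℂ)
      * ∏ i, coherentCoeff (α i) ((n + l) i) = (∏ i, _) * ∏ i, _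
  rw [Complex.ofReal_prod, ← Finset.prod_mul_distrib, ← Finset.prod_mul_distrib]
  exact Finset.prod_congr rfl fun i _ => lossWeight_mul_coherentCoeff _ _ _ _

theorem hasSum_norm_sq_fock {ι : Type*} (x : FockSpace ι) :
    HasSum (fun n => ‖x n‖ ^ 2) (‖x‖ ^ 2) := by
  simpa using lp.hasSum_norm (p := 2) (by norm_num) x

theorem lossKraus_conj_rankOne_coherentState {ι : Type*} [Fintype ι] (r : ι → unitInterval)
    (l : ι → ℕ) (α : ι → ℂ) :
    lossKraus r l ∘L InnerProductSpace.rankOne ℂ (coherentState α) (coherentState α)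
        ∘L ContinuousLinearMap.adjoint (lossKraus r l)
      = (‖coherentState (fun i => (Real.sqrt (1 - r i) : ℝ) * α i) l‖ ^ 2 : ℝ) •
        InnerProductSpace.rankOne ℂ (coherentState fun i => (Real.sqrt (r i) : ℝ) * α i)
          (coherentState fun i => (Real.sqrt (r i) : ℝ) * α i) := by
  rw [InnerProductSpace.rankOne_comp, ContinuousLinearMap.adjoint_adjoint,
    InnerProductSpace.comp_rankOne, lossKraus_coherentState]
  ext1 x
  simp only [InnerProductSpace.rankOne_apply, inner_smul_left, smul_smul,
    smul_apply]
  rw [mul_right_comm, RCLike.conj_mul, ← smul_smul]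
  norm_cast

/-- Each Kraus operator produces the same damped state, weighted by a Fock probability of the lost
coherent state. These weights sum to 1, so the output is pure. -/
theorem lossChannel_rankOne_coherentState {ι : Type*} [Fintype ι] (r : ι → unitInterval)
    (α : ι → ℂ) :
    lossChannel r (InnerProductSpace.rankOne ℂ (coherentState α) (coherentState α))
      = InnerProductSpace.rankOne ℂ (coherentState fun i => (Real.sqrt (r i) : ℝ) * α i)
          (coherentState fun i => (Real.sqrt (r i) : ℝ) * α i) := by
  simp only [lossChannel, lossKraus_conj_rankOne_coherentState]
  have h := hasSum_norm_sq_fock (coherentState fun i => (Real.sqrt (1 - r i) : ℝ) * α i)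
  rw [norm_coherentState, one_pow] at h
  simpa using (h.smul_const _).tsum_eq

/-! ### Traces against pure states -/

theorem inner_fockState_left {ι : Type*} (n : ι → ℕ) (x : FockSpace ι) :
    inner ℂ (fockState n) x = x n := by
  classical
  rw [fockState, lp.inner_single_left]
  simp

theorem inner_fockState_right {ι : Type*} (n : ι → ℕ) (x : FockSpace ι) :
    inner ℂ x (fockState n) = (starRingEnd ℂ) (x n) := by
  rw [← inner_conj_symm, inner_fockState_left]

/-- Self-adjointness of `A` moves it onto `x`, which makes the trace series literally the coordinate
series of the `ℓ²` inner product. -/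
theorem inner_fockState_rankOne_comp {ι : Type*} (x : FockSpace ι)
    {A : FockSpace ι →L[ℂ] FockSpace ι} (hA : A.IsPositive) (n : ι → ℕ) :
    inner ℂ (fockState n) ((InnerProductSpace.rankOne ℂ x x ∘L A) (fockState n))
      = inner ℂ ((A x) n) (x n) := by
  rw [ContinuousLinearMap.comp_apply, InnerProductSpace.rankOne_apply, inner_smul_right,
    inner_fockState_left, ← hA.inner_left_eq_inner_right, inner_fockState_right,
    RCLike.inner_apply, mul_comm]

theorem fockTrace_rankOne_comp {ι : Type*} (x : FockSpace ι)
    {A : FockSpace ι →L[ℂ] FockSpace ι} (hA : A.IsPositive) :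
    fockTrace (InnerProductSpace.rankOne ℂ x x ∘L A) = inner ℂ x (A x) := by
  simp only [fockTrace, inner_fockState_rankOne_comp x hA]
  rw [(lp.hasSum_inner (A x) x).tsum_eq, hA.inner_left_eq_inner_right]

/-! ### Uniform coherent inputs -/

/-- The mean of a Poisson law: shifting the index cancels the factor `n` against `n!`. -/
theorem hasSum_mul_norm_coherentCoeff_sq (α : ℂ) :
    HasSum (fun n : ℕ => (n : ℝ) * ‖coherentCoeff α n‖ ^ 2) (‖α‖ ^ 2) := by
  have h : HasSum (fun n : ℕ => ((n + 1 : ℕ) : ℝ) * ‖coherentCoeff α (n + 1)‖ ^ 2) (‖α‖ ^ 2) := by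
    have h1 := (hasSum_norm_coherentCoeff_sq α).mul_left (‖α‖ ^ 2)
    rw [mul_one] at h1
    refine h1.congr_fun fun n => ?_
    rw [norm_coherentCoeff_sq, norm_coherentCoeff_sq, Nat.factorial_succ]
    push_cast
    have : (n : ℝ) + 1 ≠ 0 := by positivity
    field_simp
    rw [pow_succ']
  have h2 := HasSum.zero_add (f := fun n : ℕ => (n : ℝ) * ‖coherentCoeff α n‖ ^ 2) h
  rwa [Nat.cast_zero, zero_mul, zero_add] at h2

theorem hasSum_photons_coherentState {m K : ℕ} (α : Fin m × Fin K → ℂ) (k : Fin m) :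
    HasSum (fun n : Fin m × Fin K → ℕ => (∑ j, (n (k, j) : ℝ)) * ‖coherentState α n‖ ^ 2)
      (∑ j, ‖α (k, j)‖ ^ 2) := by
  simp only [Finset.sum_mul]
  refine hasSum_sum fun j _ => ?_
  -- The factor `n (k, j)` is absorbed into the single mode `(k, j)`, so that the summand is a
  -- product over modes.
  have h := hasSum_prod_pi
    (f := fun i n => (if i = (k, j) then (n : ℝ) else 1) * ‖coherentCoeff (α i) n‖ ^ 2)
    (a := fun i => if i = (k, j) then ‖α (k, j)‖ ^ 2 else 1) (fun i => ?_) fun i => ?_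
  · rw [Finset.prod_ite_eq' Finset.univ, if_pos (Finset.mem_univ _)] at h
    refine h.congr_fun fun n => ?_
    rw [Finset.prod_mul_distrib, Finset.prod_ite_eq' Finset.univ, if_pos (Finset.mem_univ _)]
    simp [coherentState, norm_prod, Finset.prod_pow]
  · split_ifs with hi
    · rw [hi]; exact hasSum_mul_norm_coherentCoeff_sq _
    · simpa using hasSum_norm_coherentCoeff_sq (α i)
  · split_ifs with hi
    · exact (hasSum_mul_norm_coherentCoeff_sq _).summable.norm
    · simpa using (hasSum_norm_coherentCoeff_sq (α i)).summable

theorem inner_fockState_rankOne {ι : Type*} (x : FockSpace ι) (n : ι → ℕ) :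
    inner ℂ (fockState n) (InnerProductSpace.rankOne ℂ x x (fockState n))
      = ((‖x n‖ ^ 2 : ℝ) : ℂ) := by
  rw [InnerProductSpace.rankOne_apply, inner_smul_right, inner_fockState_left,
    inner_fockState_right, RCLike.conj_mul]
  norm_cast

theorem meanPhotons_gusCoherent {m K : ℕ} (β : EuclideanSpace ℂ (Fin K)) (k : Fin m) :
    meanPhotons (gusCoherent m β) k = ENNReal.ofReal (‖β‖ ^ 2) := by
  have h := hasSum_photons_coherentState (fun i : Fin m × Fin K => β i.2) k
  rw [EuclideanSpace.norm_sq_eq, ← h.tsum_eq, ENNReal.ofReal_tsum_of_nonneg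
    (fun n => mul_nonneg (Finset.sum_nonneg fun j _ => Nat.cast_nonneg _) (sq_nonneg _))
    h.summable]
  simp only [meanPhotons, gusCoherent, inner_fockState_rankOne, Complex.ofReal_re]

/-- The output state of the channel `𝓔ₙ` for the input `⨂ₖ |β⟩_{Sₖ}`. -/
def cellOutput {m K : ℕ} (rB rT : unitInterval) (n : Fin m) (β : EuclideanSpace ℂ (Fin K)) :
    FockSpace (Fin m × Fin K) :=
  coherentState fun i => (Real.sqrt (if i.1 = n then rT else rB : unitInterval) : ℝ) * β i.2

theorem norm_cellOutput {m K : ℕ} (rB rT : unitInterval) (n : Fin m)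
    (β : EuclideanSpace ℂ (Fin K)) : ‖cellOutput rB rT n β‖ = 1 :=
  norm_coherentState _

theorem continuous_cellOutput {m K : ℕ} (rB rT : unitInterval) (n : Fin m) :
    Continuous (cellOutput rB rT n : EuclideanSpace ℂ (Fin K) → _) :=
  continuous_coherentState.comp (by fun_prop)

theorem cellChannel_gusCoherent {m K : ℕ} (rB rT : unitInterval) (n : Fin m)
    (β : EuclideanSpace ℂ (Fin K)) :
    cellChannel rB rT n (gusCoherent m β)
      = InnerProductSpace.rankOne ℂ (cellOutput rB rT n β) (cellOutput rB rT n β) :=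
  lossChannel_rankOne_coherentState _ _

theorem inner_coherentState_real_mul {ι : Type*} [Fintype ι] (a b : ι → ℝ) (β : ι → ℂ) :
    inner ℂ (coherentState fun i => (a i : ℂ) * β i) (coherentState fun i => (b i : ℂ) * β i)
      = (Real.exp (-∑ i, (a i - b i) ^ 2 / 2 * ‖β i‖ ^ 2) : ℂ) := by
  rw [inner_coherentState, Complex.ofReal_exp, Complex.ofReal_neg, Complex.ofReal_sum,
    ← Finset.sum_neg_distrib]
  congr 1
  refine Finset.sum_congr rfl fun i _ => ?_
  have ha : ((‖(a i : ℂ) * β i‖ : ℝ) : ℂ) ^ 2 = (a i : ℂ) ^ 2 * (‖β i‖ : ℂ) ^ 2 := by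
    rw [norm_mul, Complex.norm_real, ← Complex.ofReal_pow, mul_pow, Real.norm_eq_abs, sq_abs]
    push_cast; ring
  have hb : ((‖(b i : ℂ) * β i‖ : ℝ) : ℂ) ^ 2 = (b i : ℂ) ^ 2 * (‖β i‖ : ℂ) ^ 2 := by
    rw [norm_mul, Complex.norm_real, ← Complex.ofReal_pow, mul_pow, Real.norm_eq_abs, sq_abs]
    push_cast; ring
  rw [ha, hb, map_mul, Complex.conj_ofReal]
  push_cast
  linear_combination (a i : ℂ) * b i * Complex.conj_mul' (β i)

/-- For `n ≠ n'` only cells `n` and `n'` differ. Each contributes half of the exponent, so the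
overlap is the square of the one-cell overlap. -/
theorem inner_cellOutput {m K : ℕ} (rB rT : unitInterval) (n n' : Fin m)
    (β : EuclideanSpace ℂ (Fin K)) :
    inner ℂ (cellOutput rB rT n β) (cellOutput rB rT n' β)
      = if n = n' then 1 else
        ((Real.exp (-(‖β‖ ^ 2 * (Real.sqrt rB - Real.sqrt rT) ^ 2)) : ℝ) : ℂ) := by
  split_ifs with h
  · subst h
    rw [inner_self_eq_norm_sq_to_K, norm_cellOutput]; simp
  · rw [cellOutput, cellOutput, inner_coherentState_real_mul]
    congr 3
    rw [Fintype.sum_prod_type]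
    change ∑ k : Fin m, ∑ j, (Real.sqrt (if k = n then rT else rB : unitInterval)
        - Real.sqrt (if k = n' then rT else rB : unitInterval)) ^ 2 / 2 * ‖β j‖ ^ 2 = _
    rw [EuclideanSpace.norm_sq_eq, ← Finset.sum_mul_sum]
    have hk : ∀ k : Fin m, (Real.sqrt (if k = n then rT else rB : unitInterval)
        - Real.sqrt (if k = n' then rT else rB : unitInterval)) ^ 2 / 2
        = (if k = n then (Real.sqrt rB - Real.sqrt rT) ^ 2 / 2 else 0)
          + if k = n' then (Real.sqrt rB - Real.sqrt rT) ^ 2 / 2 else 0 := by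
      intro k
      by_cases h1 : k = n
      · have h2 : k ≠ n' := fun h2 => h (h1.symm.trans h2)
        rw [if_pos h1, if_neg h2, if_pos h1, if_neg h2]; ring
      · by_cases h2 : k = n'
        · rw [if_neg h1, if_pos h2, if_neg h1, if_pos h2]; ring
        · rw [if_neg h1, if_neg h2, if_neg h1, if_neg h2]; ring
    rw [Finset.sum_congr rfl fun k _ => hk k, Finset.sum_add_distrib]
    simp
    ring

theorem errorProb_gusCoherent {m K : ℕ} (rB rT : unitInterval) (β : EuclideanSpace ℂ (Fin K))
    {P : Fin m → CellOperator m K} (hP : IsPOVM P) :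
    errorProb rB rT (gusCoherent m β) P
      = 1 - 1 / m * ∑ n, (inner ℂ (cellOutput rB rT n β) (P n (cellOutput rB rT n β))).re := by
  rw [errorProb, Finset.mul_sum]
  congr 1
  refine Finset.sum_congr rfl fun n _ => ?_
  rw [cellChannel_gusCoherent, fockTrace_rankOne_comp _ (hP.1 n)]

theorem helstromPPM_le_errorProb_gusCoherent {m K : ℕ} (hm : 1 ≤ m) (rB rT : unitInterval)
    (β : EuclideanSpace ℂ (Fin K)) {P : Fin m → CellOperator m K} (hP : IsPOVM P) :
    helstromPPM m (Real.exp (-(‖β‖ ^ 2 * (Real.sqrt rB - Real.sqrt rT) ^ 2)))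
      ≤ errorProb rB rT (gusCoherent m β) P := by
  have hm0 : (0 : ℝ) < m := by exact_mod_cast hm
  have h := sum_re_inner_le hm (Real.exp_pos _).le
    (Real.exp_le_one_iff.2 (neg_nonpos.2 (by positivity))) _
    (fun n n' => inner_cellOutput rB rT n n' β) P hP.1 hP.2
  rw [errorProb_gusCoherent rB rT β hP, one_div, le_sub_comm]
  exact (inv_mul_le_iff₀ hm0).2 h

theorem isLeast_errorProbs_gusCoherent {m K : ℕ} (hm : 1 ≤ m) (rB rT : unitInterval)
    (β : EuclideanSpace ℂ (Fin K)) :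
    IsLeast (errorProbs rB rT (gusCoherent m β))
      (helstromPPM m (Real.exp (-(‖β‖ ^ 2 * (Real.sqrt rB - Real.sqrt rT) ^ 2)))) := by
  have hm0 : (0 : ℝ) < m := by exact_mod_cast hm
  constructor
  · obtain ⟨P, hP1, hP2, h⟩ := exists_povm_le_sum_re_inner hm (Real.exp_pos _).le
      (Real.exp_le_one_iff.2 (neg_nonpos.2 (by positivity))) _
      (fun n n' => inner_cellOutput rB rT n n' β)
    have hP : IsPOVM P := ⟨hP1, hP2⟩
    refine ⟨P, hP, (helstromPPM_le_errorProb_gusCoherent hm rB rT β hP).antisymm ?_⟩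
    rw [errorProb_gusCoherent rB rT β hP, one_div, sub_le_comm]
    exact (le_inv_mul_iff₀ hm0).2 h
  · rintro p ⟨P, hP, rfl⟩
    exact helstromPPM_le_errorProb_gusCoherent hm rB rT β hP

/-! ### Mixtures of uniform coherent inputs -/

theorem continuous_rankOne_self {X H : Type*} [TopologicalSpace X] [NormedAddCommGroup H]
    [InnerProductSpace ℂ H] {φ : X → H} (hφ : Continuous φ) :
    Continuous fun a => InnerProductSpace.rankOne ℂ (φ a) (φ a) :=
  ((ContinuousLinearMap.smulRightL ℂ H H).continuous.comp
    ((innerSL ℂ).continuous.comp hφ)).clm_apply hφ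

theorem sum_norm_sq_fock_le {ι : Type*} (x : FockSpace ι) (s : Finset (ι → ℕ)) :
    ∑ n ∈ s, ‖x n‖ ^ 2 ≤ ‖x‖ ^ 2 :=
  sum_le_hasSum s (fun _ _ => sq_nonneg _) (hasSum_norm_sq_fock x)

/-- Supplies the summability that permits exchanging series and Bochner integrals, both for the
Kraus sum and for the trace. -/
theorem summable_integral_of_sum_le {X κ : Type*} [MeasurableSpace X] (ν : Measure X)
    [IsProbabilityMeasure ν] {g : κ → X → ℝ} (h0 : ∀ l a, 0 ≤ g l a)
    (hg : ∀ l, Integrable (g l) ν) {C : ℝ} (hC : ∀ (s : Finset κ) a, ∑ l ∈ s, g l a ≤ C) :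
    Summable fun l => ∫ a, g l a ∂ν := by
  refine summable_of_sum_le (c := C) (fun l => integral_nonneg (h0 l)) fun s => ?_
  rw [← integral_finsetSum s fun l _ => hg l]
  refine (integral_mono (integrable_finsetSum s fun l _ => hg l) (integrable_const C)
    (hC s)).trans ?_
  simp

theorem inner_integral_apply {X ι : Type*} [MeasurableSpace X] {ν : Measure X}
    {F : X → FockSpace ι →L[ℂ] FockSpace ι} (hF : Integrable F ν) (x y : FockSpace ι) :
    inner ℂ x ((∫ a, F a ∂ν) y) = ∫ a, inner ℂ x (F a y) ∂ν := by
  have h := (hF.apply_continuousLinearMap y)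
  exact (congrArg (inner ℂ x) (ContinuousLinearMap.integral_apply hF y)).trans
    (integral_inner h x).symm

/-! ### Integrals commute with the loss channel and with the trace. -/

section Mixture

variable {X : Type*} [MeasurableSpace X] [TopologicalSpace X] [OpensMeasurableSpace X]
  [SecondCountableTopology X] (ν : Measure X) [IsProbabilityMeasure ν]

theorem integrable_of_continuous_of_bound {G : Type*} [NormedAddCommGroup G] {f : X → G}
    (hf : Continuous f) (C : ℝ) (hC : ∀ a, ‖f a‖ ≤ C) : Integrable f ν :=
  Integrable.of_bound hf.aestronglyMeasurable C (Eventually.of_forall hC)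

theorem integrable_rankOne_self {H : Type*} [NormedAddCommGroup H]
    [InnerProductSpace ℂ H] {φ : X → H} (hφ : Continuous φ) (h1 : ∀ a, ‖φ a‖ = 1) :
    Integrable (fun a => InnerProductSpace.rankOne ℂ (φ a) (φ a)) ν :=
  integrable_of_continuous_of_bound ν (continuous_rankOne_self hφ) 1 fun a => by simp [h1]

theorem lossChannel_integral_coherentState {ι : Type*} [Fintype ι] (r : ι → unitInterval)
    {φ : X → ι → ℂ} (hφ : Continuous φ) :
    lossChannel r (∫ a, InnerProductSpace.rankOne ℂ (coherentState (φ a))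
        (coherentState (φ a)) ∂ν)
      = ∫ a, InnerProductSpace.rankOne ℂ
          (coherentState fun i => (Real.sqrt (r i) : ℝ) * φ a i)
          (coherentState fun i => (Real.sqrt (r i) : ℝ) * φ a i) ∂ν := by
  have hint := integrable_rankOne_self ν (continuous_coherentState.comp hφ)
    fun a => norm_coherentState (φ a)
  -- Conjugation by a Kraus operator as a bounded linear map on operators, so that it commutes with
  -- the Bochner integral.
  let L : (ι → ℕ) → (FockSpace ι →L[ℂ] FockSpace ι) →L[ℂ] (FockSpace ι →L[ℂ] FockSpace ι) :=
    fun l => (ContinuousLinearMap.compL ℂ _ _ _ (lossKraus r l)).comp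
      ((ContinuousLinearMap.compL ℂ _ _ _).flip (ContinuousLinearMap.adjoint (lossKraus r l)))
  have hL : ∀ l T, L l T = lossKraus r l ∘L T ∘L ContinuousLinearMap.adjoint (lossKraus r l) :=
    fun _ _ => rfl
  have hLi : ∀ l, Integrable (fun a => L l (InnerProductSpace.rankOne ℂ (coherentState (φ a))
      (coherentState (φ a)))) ν := fun l => (L l).integrable_comp hint
  have hnorm : ∀ l a, ‖L l (InnerProductSpace.rankOne ℂ (coherentState (φ a))
      (coherentState (φ a)))‖ = ‖coherentState (fun i => (Real.sqrt (1 - r i) : ℝ) * φ a i) l‖ ^ 2 := by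
    intro l a
    rw [hL, lossKraus_conj_rankOne_coherentState, norm_smul, InnerProductSpace.norm_rankOne,
      norm_coherentState, Real.norm_of_nonneg (sq_nonneg _), mul_one, mul_one]
  have hsum : Summable fun l => ∫ a, ‖L l (InnerProductSpace.rankOne ℂ (coherentState (φ a))
      (coherentState (φ a)))‖ ∂ν := by
    refine summable_integral_of_sum_le ν (fun _ _ => norm_nonneg _) (fun l => (hLi l).norm)
      (C := 1) fun s a => ?_
    simp only [hnorm]
    refine (sum_norm_sq_fock_le _ s).trans ?_
    rw [norm_coherentState, one_pow]
  simp only [lossChannel, ← hL]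
  calc ∑' l, L l (∫ a, InnerProductSpace.rankOne ℂ (coherentState (φ a))
        (coherentState (φ a)) ∂ν)
      = ∑' l, ∫ a, L l (InnerProductSpace.rankOne ℂ (coherentState (φ a))
        (coherentState (φ a))) ∂ν :=
        tsum_congr fun l => ((L l).integral_comp_comm hint).symm
    _ = ∫ a, ∑' l, L l (InnerProductSpace.rankOne ℂ (coherentState (φ a))
        (coherentState (φ a))) ∂ν :=
        (hasSum_integral_of_summable_integral_norm hLi hsum).tsum_eq
    _ = _ := integral_congr_ae (Eventually.of_forall fun a =>
        lossChannel_rankOne_coherentState r (φ a))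

theorem fockTrace_integral_rankOne_comp {ι : Type*} [Finite ι] {φ : X → FockSpace ι}
    (hφ : Continuous φ) (h1 : ∀ a, ‖φ a‖ = 1) {A : FockSpace ι →L[ℂ] FockSpace ι}
    (hA : A.IsPositive) :
    fockTrace ((∫ a, InnerProductSpace.rankOne ℂ (φ a) (φ a) ∂ν) ∘L A)
      = ∫ a, inner ℂ (φ a) (A (φ a)) ∂ν := by
  have hint := integrable_rankOne_self ν hφ h1
  have hterm : ∀ n, inner ℂ (fockState n)
      (((∫ a, InnerProductSpace.rankOne ℂ (φ a) (φ a) ∂ν) ∘L A) (fockState n))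
      = ∫ a, inner ℂ ((A (φ a)) n) (φ a n) ∂ν := by
    intro n
    rw [ContinuousLinearMap.comp_apply, inner_integral_apply hint]
    exact integral_congr_ae (Eventually.of_forall fun a =>
      inner_fockState_rankOne_comp (φ a) hA n)
  have hcoord : ∀ n, Continuous fun x : FockSpace ι => x n := by
    intro n
    have : (fun x : FockSpace ι => x n) = fun x => inner ℂ (fockState n) x := by
      ext x; rw [inner_fockState_left]
    rw [this]; fun_prop
  have hA1 : ∀ a, ‖A (φ a)‖ ^ 2 ≤ ‖A‖ ^ 2 := fun a => by
    gcongr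
    simpa [h1] using A.le_opNorm (φ a)
  -- AM-GM on each term; summed over `n`, this is bounded uniformly in `a` by the norms of `A (φ a)`
  -- and `φ a`.
  have hle : ∀ n a, ‖(inner ℂ ((A (φ a)) n) (φ a n) : ℂ)‖
      ≤ (‖A (φ a) n‖ ^ 2 + ‖φ a n‖ ^ 2) / 2 := by
    intro n a
    refine (norm_inner_le_norm _ _).trans ?_
    nlinarith [sq_nonneg (‖A (φ a) n‖ - ‖φ a n‖)]
  have hle' : ∀ (s : Finset (ι → ℕ)) a, ∑ n ∈ s, ‖(inner ℂ ((A (φ a)) n) (φ a n) : ℂ)‖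
      ≤ (‖A‖ ^ 2 + 1) / 2 := by
    intro s a
    refine (Finset.sum_le_sum fun n _ => hle n a).trans ?_
    rw [← Finset.sum_div, Finset.sum_add_distrib]
    have e1 := (sum_norm_sq_fock_le (A (φ a)) s).trans (hA1 a)
    have e2 := sum_norm_sq_fock_le (φ a) s
    rw [h1, one_pow] at e2
    linarith
  have hFi : ∀ n, Integrable (fun a => (inner ℂ ((A (φ a)) n) (φ a n) : ℂ)) ν := fun n =>
    integrable_of_continuous_of_bound ν
      (((hcoord n).comp (A.continuous.comp hφ)).inner ((hcoord n).comp hφ))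
      ((‖A‖ ^ 2 + 1) / 2) fun a => by simpa using hle' {n} a
  have hsum : Summable fun n => ∫ a, ‖(inner ℂ ((A (φ a)) n) (φ a n) : ℂ)‖ ∂ν :=
    summable_integral_of_sum_le ν (fun _ _ => norm_nonneg _) (fun n => (hFi n).norm) hle'
  simp only [fockTrace, hterm]
  rw [(hasSum_integral_of_summable_integral_norm hFi hsum).tsum_eq]
  refine integral_congr_ae (Eventually.of_forall fun a => ?_)
  change ∑' n, _ = _
  rw [(lp.hasSum_inner (A (φ a)) (φ a)).tsum_eq, hA.inner_left_eq_inner_right]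

end Mixture

theorem integral_norm_sq_le {K : ℕ} (ν : Measure (EuclideanSpace ℂ (Fin K))) {N : ℝ} (hN : 0 ≤ N)
    (h : ∫⁻ β, ENNReal.ofReal (‖β‖ ^ 2) ∂ν ≤ ENNReal.ofReal N) :
    Integrable (fun β => ‖β‖ ^ 2) ν ∧ ∫ β, ‖β‖ ^ 2 ∂ν ≤ N := by
  have hm : AEStronglyMeasurable (fun β : EuclideanSpace ℂ (Fin K) => ‖β‖ ^ 2) ν :=
    (continuous_norm.pow 2).aestronglyMeasurable
  have h0 : 0 ≤ᵐ[ν] fun β : EuclideanSpace ℂ (Fin K) => ‖β‖ ^ 2 :=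
    Eventually.of_forall fun β => sq_nonneg _
  refine ⟨⟨hm, ?_⟩, ?_⟩
  · rw [hasFiniteIntegral_iff_ofReal h0]
    exact h.trans_lt ENNReal.ofReal_lt_top
  · rw [integral_eq_lintegral_of_nonneg_ae h0 hm]
    exact ENNReal.toReal_le_of_le_ofReal hN h

/-! ### Error probability and energy of mixtures of uniform coherent states. -/

section GusMixture

variable {m K : ℕ} (ν : Measure (EuclideanSpace ℂ (Fin K))) [IsProbabilityMeasure ν]

theorem cellChannel_gusMixture (rB rT : unitInterval) (n : Fin m) :
    cellChannel rB rT n (gusMixture m ν) = ∫ β, InnerProductSpace.rankOne ℂ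
      (cellOutput rB rT n β) (cellOutput rB rT n β) ∂ν :=
  lossChannel_integral_coherentState ν _ (by fun_prop)

theorem integrable_inner_cellOutput (rB rT : unitInterval) (n : Fin m)
    (A : CellOperator m K) :
    Integrable (fun β => inner ℂ (cellOutput rB rT n β) (A (cellOutput rB rT n β))) ν := by
  have hc := continuous_cellOutput (K := K) rB rT n
  refine integrable_of_continuous_of_bound ν (hc.inner (A.continuous.comp hc)) ‖A‖ fun β => ?_
  refine (norm_inner_le_norm _ _).trans ?_
  simpa [norm_cellOutput] using A.le_opNorm (cellOutput rB rT n β)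

theorem integrable_errorProb_gusCoherent (rB rT : unitInterval) {P : Fin m → CellOperator m K}
    (hP : IsPOVM P) : Integrable (fun β => errorProb rB rT (gusCoherent m β) P) ν := by
  simp only [errorProb_gusCoherent rB rT _ hP]
  exact (integrable_const _).sub ((integrable_finsetSum _ fun n _ =>
    (integrable_inner_cellOutput ν rB rT n (P n)).re).const_mul _)

theorem errorProb_gusMixture (rB rT : unitInterval) {P : Fin m → CellOperator m K}
    (hP : IsPOVM P) :
    errorProb rB rT (gusMixture m ν) P = ∫ β, errorProb rB rT (gusCoherent m β) P ∂ν := by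
  have hi : ∀ n, Integrable (fun β =>
      (inner ℂ (cellOutput rB rT n β) (P n (cellOutput rB rT n β))).re) ν :=
    fun n => (integrable_inner_cellOutput ν rB rT n (P n)).re
  simp only [errorProb_gusCoherent rB rT _ hP]
  rw [integral_sub (integrable_const _) ((integrable_finsetSum _ fun n _ => hi n).const_mul _),
    integral_const_mul, integral_finsetSum _ fun n _ => hi n, errorProb, ← Finset.mul_sum]
  simp only [integral_const, probReal_univ, one_smul]
  congr 2
  refine Finset.sum_congr rfl fun n _ => ?_
  rw [cellChannel_gusMixture, fockTrace_integral_rankOne_comp ν (continuous_cellOutput rB rT n)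
    (norm_cellOutput rB rT n) (hP.1 n)]
  exact (integral_re (integrable_inner_cellOutput ν rB rT n (P n))).symm

/-- Tonelli in `ℝ≥0∞`, so the identity holds even for infinite energy. The value does not depend on
the cell. -/
theorem meanPhotons_gusMixture (k : Fin m) :
    meanPhotons (gusMixture m ν) k = ∫⁻ β, ENNReal.ofReal (‖β‖ ^ 2) ∂ν := by
  have hc : Continuous fun β : EuclideanSpace ℂ (Fin K) =>
      coherentState fun i : Fin m × Fin K => β i.2 := continuous_coherentState.comp (by fun_prop)
  have hcn : ∀ n : Fin m × Fin K → ℕ, Continuous fun β : EuclideanSpace ℂ (Fin K) =>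
      ‖coherentState (fun i : Fin m × Fin K => β i.2) n‖ ^ 2 := by
    intro n
    simp only [← inner_fockState_left]
    fun_prop
  have hint := integrable_rankOne_self ν hc fun _ => norm_coherentState _
  simp only [← meanPhotons_gusCoherent (m := m) _ k, meanPhotons, gusCoherent,
    inner_fockState_rankOne, Complex.ofReal_re]
  rw [lintegral_tsum]
  · refine tsum_congr fun n => ?_
    rw [gusMixture]
    simp only [gusCoherent]
    rw [inner_integral_apply hint]
    simp only [inner_fockState_rankOne]
    rw [integral_complex_ofReal, Complex.ofReal_re, ← integral_const_mul,
      ofReal_integral_eq_lintegral_ofReal]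
    · refine (integrable_of_continuous_of_bound ν (hcn n) 1 fun β => ?_).const_mul _
      rw [Real.norm_of_nonneg (sq_nonneg _)]
      have h := sum_norm_sq_fock_le (coherentState fun i : Fin m × Fin K => β i.2) {n}
      rwa [Finset.sum_singleton, norm_coherentState, one_pow] at h
    · exact Eventually.of_forall fun β =>
        mul_nonneg (Finset.sum_nonneg fun j _ => Nat.cast_nonneg _) (sq_nonneg _)
  · exact fun n => (((hcn n).const_mul _).measurable.ennreal_ofReal).aemeasurable

theorem helstromPPM_le_errorProb_gusMixture (hm : 1 ≤ m) (rB rT : unitInterval) {N : ℝ}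
    (hN : 0 ≤ N) (h : ∫⁻ β, ENNReal.ofReal (‖β‖ ^ 2) ∂ν ≤ ENNReal.ofReal N)
    {P : Fin m → CellOperator m K} (hP : IsPOVM P) :
    helstromPPM m (Real.exp (-(N * (Real.sqrt rB - Real.sqrt rT) ^ 2)))
      ≤ errorProb rB rT (gusMixture m ν) P := by
  obtain ⟨hi, hle⟩ := integral_norm_sq_le ν hN h
  rw [errorProb_gusMixture ν rB rT hP]
  set c := (Real.sqrt rB - Real.sqrt rT) ^ 2 with hc
  have hc0 : 0 ≤ c := sq_nonneg _
  let f : EuclideanSpace ℂ (Fin K) → ℝ := fun β => Real.exp (-(‖β‖ ^ 2 * c))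
  have hf01 : ∀ β, f β ∈ Set.Icc (0 : ℝ) 1 := fun β =>
    ⟨(Real.exp_pos _).le, Real.exp_le_one_iff.2 (neg_nonpos.2 (by positivity))⟩
  have hfc : Continuous f := by fun_prop
  have hfi : Integrable f ν := integrable_of_continuous_of_bound ν hfc 1 fun β => by
    rw [Real.norm_of_nonneg (hf01 β).1]; exact (hf01 β).2
  have hbound : ∀ β, helstromPPM m (f β) ≤ errorProb rB rT (gusCoherent m β) P := fun β =>
    helstromPPM_le_errorProb_gusCoherent hm rB rT β hP
  -- Dominated by the error probability of the given POVM.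
  have hhi : Integrable (fun β => helstromPPM m (f β)) ν := by
    refine (integrable_errorProb_gusCoherent ν rB rT hP).mono'
      ((continuous_helstromPPM m).comp hfc).aestronglyMeasurable (Eventually.of_forall fun β => ?_)
    rw [Real.norm_of_nonneg (helstromPPM_nonneg hm _)]
    exact hbound β
  -- Jensen for `exp`; the energy bound then enters through monotonicity of `exp`.
  have hexp : Real.exp (-(N * c)) ≤ ∫ β, f β ∂ν := by
    have hgi : Integrable (fun β : EuclideanSpace ℂ (Fin K) => -(‖β‖ ^ 2 * c)) ν :=
      (hi.mul_const c).neg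
    refine le_trans ?_ (convexOn_exp.map_integral_le Real.continuous_exp.continuousOn
      isClosed_univ (Eventually.of_forall fun _ => Set.mem_univ _) hgi hfi)
    rw [integral_neg, integral_mul_const]
    gcongr
  calc helstromPPM m (Real.exp (-(N * c))) ≤ helstromPPM m (∫ β, f β ∂ν) :=
        helstromPPM_mono hm (Real.exp_pos _).le hexp
    _ ≤ ∫ β, helstromPPM m (f β) ∂ν :=
        (helstromPPM_convexOn hm).map_integral_le (continuous_helstromPPM m).continuousOn
          isClosed_Icc (Eventually.of_forall hf01) hfi hhi
    _ ≤ _ := integral_mono hhi (integrable_errorProb_gusCoherent ν rB rT hP) hbound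

end GusMixture

/-- The measurement that always guesses the first cell. Nonemptiness is required to bound the real
`sInf` from below. -/
theorem nonempty_errorProbs {m K : ℕ} (hm : 1 ≤ m) (rB rT : unitInterval)
    (ρ : CellOperator m K) : (errorProbs rB rT ρ).Nonempty := by
  refine ⟨_, Pi.single ⟨0, hm⟩ 1, ⟨fun n => ?_, by simp⟩, rfl⟩
  rcases eq_or_ne n ⟨0, hm⟩ with rfl | hn
  · simp
  · simp [hn]

end

/-- `α = √(M N_S)` is the amplitude of the optimal coherent state, with one mode per cell, and
`ζ = exp(-M N_S (√r_B - √r_T)²)`. -/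
theorem lemma2 (m M : ℕ) (hm : 1 ≤ m) (NS : ℝ) (hNS : 0 ≤ NS) (rB rT : unitInterval)
    (α : ℝ) (hα : α = Real.sqrt (M * NS))
    (ζ : ℝ) (hζ : ζ = Real.exp (-(M * NS * (Real.sqrt rB - Real.sqrt rT) ^ 2)))
    (ρopt : CellOperator m 1)
    (hρopt : ρopt = gusCoherent m (WithLp.toLp 2 fun _ : Fin 1 => (α : ℂ))) :
    -- the uniform coherent input irradiates `M N_S` mean photons over each cell
    (∀ k, meanPhotons ρopt k = ENNReal.ofReal (M * NS)) ∧
    -- its minimum error probability is `P_H(m, ζ)`, and some measurement attains it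
    IsLeast (errorProbs rB rT ρopt) (helstromPPM m ζ) ∧
    minErrorProb rB rT ρopt = helstromPPM m ζ ∧
    -- `ζ` is the overlap of the two possible output states of a cell
    ‖inner ℂ (coherentState fun _ : Fin 1 => ((Real.sqrt rB * α : ℝ) : ℂ))
      (coherentState fun _ : Fin 1 => ((Real.sqrt rT * α : ℝ) : ℂ))‖ ^ 2 = ζ ∧
    -- no mixture of uniform coherent inputs, with any number of modes per cell, does better
    (∀ (K : ℕ) (ν : Measure (EuclideanSpace ℂ (Fin K))) [IsProbabilityMeasure ν],
      (∀ k, meanPhotons (gusMixture m ν) k ≤ ENNReal.ofReal (M * NS)) →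
      minErrorProb rB rT ρopt ≤ minErrorProb rB rT (gusMixture m ν)) ∧
    -- uniform coherent inputs with `M N_S` photons distributed over `K` modes are equivalent
    (∀ (K : ℕ) (β : EuclideanSpace ℂ (Fin K)), ‖β‖ ^ 2 = M * NS →
      IsLeast (errorProbs rB rT (gusCoherent m β)) (helstromPPM m ζ)) := by

  have hN : 0 ≤ (M : ℝ) * NS := by positivity
  have hα2 : α ^ 2 = M * NS := by rw [hα, Real.sq_sqrt hN]
  have hnorm : ‖(WithLp.toLp 2 fun _ : Fin 1 => (α : ℂ) : EuclideanSpace ℂ (Fin 1))‖ ^ 2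
      = M * NS := by
    rw [EuclideanSpace.norm_sq_eq]
    simp [hα2]
  have hcoh : ∀ (K : ℕ) (β : EuclideanSpace ℂ (Fin K)), ‖β‖ ^ 2 = M * NS →
      IsLeast (errorProbs rB rT (gusCoherent m β)) (helstromPPM m ζ) := by
    intro K β hβ
    rw [hζ, ← hβ]
    exact isLeast_errorProbs_gusCoherent hm rB rT β
  have hopt : IsLeast (errorProbs rB rT ρopt) (helstromPPM m ζ) := hρopt ▸ hcoh 1 _ hnorm
  have hmin : minErrorProb rB rT ρopt = helstromPPM m ζ := hopt.csInf_eq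
  refine ⟨fun k => ?_, hopt, hmin, ?_, fun K ν _ hν => ?_, hcoh⟩
  · rw [hρopt, meanPhotons_gusCoherent, hnorm]
  · have h := inner_coherentState_real_mul (fun _ : Fin 1 => Real.sqrt rB)
      (fun _ => Real.sqrt rT) (fun _ => (α : ℂ))
    simp only [Complex.ofReal_mul, h, Complex.norm_real]
    rw [Real.norm_of_nonneg (Real.exp_pos _).le, ← Real.exp_nat_mul, hζ, ← hα2]
    congr 1
    simp
    ring
  -- All cells receive the same mean photon number, so one cell carries the whole constraint.
  · have hle := hν ⟨0, hm⟩
    rw [meanPhotons_gusMixture] at hle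
    rw [hmin, hζ]
    refine le_csInf (nonempty_errorProbs hm rB rT _) ?_
    rintro p ⟨P, hP, rfl⟩
    exact helstromPPM_le_errorProb_gusMixture ν hm rB rT hN hle hP
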